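/- Let $S$ be a finite set with a total order $<$, let $R$ be a commutative ring with $1$, and let $A = R\langle t_s \mid s\in S\rangle$ be the ring of noncommutative polynomials over $R$. Order the monomials of $A$ by the degree lexicographic order: $t_{i_1}\cdots t_{i_k} \prec t_{j_1}\cdots t_{j_l}$ if and only if $k<l$, or $k=l$ and for some $0\le h<k$ we have $i_1=j_1,\dots,i_h=j_h$ and $i_{h+1}<j_{h+1}$. For $f \in A\setminus\{0\}$ let $\mathrm{lt}(f)$ be the leading term of $f$, that is, the largest monomial of $f$ together with its coefficient. A subset $G$ of a two-sided ideal $I$ of $A$ is a Gröbner basis of $I$ if the two-sided ideal generated by $\{\mathrm{lt}(g) \mid g\in G,\ g \neq 0\}$ coincides with the one generated by $\{\mathrm{lt}(f)\mid f\in I,\ f \neq 0\}$. Write every $J\subseteq S$ as $J=\{j_1<\dots<j_{\#J}\}$ and put $t_J=t_{j_1}\cdots t_{j_{\#J}}$; for $J,K\subseteq S$ write $J\prec K$ if $t_J\prec t_K$. Let $\mathfrak M$ be the set of circuits of a matroid on the ground set $S$ without loops and without parallel elements. For $q\in R$ let $I_q(\mathfrak M)$ be the two-sided ideal of $A$ generated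 by $t_s^2-q$ for $s\in S$, by $t_rt_s+t_st_r-2q$ for $r,s\in S$ with $s<r$, and by $$t^-_J=\sum_{I\subseteq J,\ 2\nmid \#I}(-1)^{\ell_J(I)}(-q)^{(\#I-1)/2}\,t_{J\setminus I},\qquad J\in\mathfrak M,$$ where $\ell_J(I)=\sum_{\nu=1}^{\#I}(\alpha_\nu-\nu)$ for $I=\{j_{\alpha_1}<\dots<j_{\alpha_{\#I}}\}$. The algebra $A/I_0(\mathfrak M)$ is the Orlik–Solomon algebra of $\mathfrak M$. Call $J\subseteq S$ dependent if it contains a circuit. Write $K\sqsubseteq J$ if $K\subseteq J$ and every $j\in J$ with $k<j<k'$ for some $k,k'\in K$ lies in $K$. Let $\overline{\mathfrak M}$ be the set of subsets of $S$, the Gröbner circuits, defined recursively along $\prec$ as follows: $J\in\overline{\mathfrak M}$ if and only if $J$ is dependent and there is no $K\in\overline{\mathfrak M}$ with $K\prec J$ and $K\setminus\{k_1\}\sqsubseteq J\setminus\{j_1\}$. Then the polynomials $t_s^2$ with $s\in S$, $t_rt_s+t_st_r$ with $r,s\in S$, $s<r$, and $$\sum_{\nu=1}^{\#J}(-1)^{\nu-1}\,t_{J\setminus\{j_\nu\}}\quad\text{with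 } J\in\overline{\mathfrak M}$$ form a Gröbner basis of the ideal $I_0(\mathfrak M)$ with respect to the degree lexicographic order. -/

import Mathlib

/-! Noncommutative polynomials, Gröbner bases for the degree lexicographic order, the ideals
`I_q(𝔐)` of a set system, and Gröbner circuits. -/

namespace OrlikSolomon

/-! ### Noncommutative polynomials and Gröbner bases -/

section Groebner

/-- The ring `R⟨t_s | s ∈ S⟩` of noncommutative polynomials: the `R`-algebra with `R`-basis the
noncommutative monomials in the variables `t_s`, i.e. the words over `S`. (It is isomorphic to
`FreeAlgebra R S` by `FreeAlgebra.equivMonoidAlgebraFreeMonoid`.) -/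
abbrev NCPoly (R S : Type*) [CommRing R] : Type _ := MonoidAlgebra R (FreeMonoid S)

variable {R S : Type*} [CommRing R]

/-- The monomial `t_{s_1} ⋯ t_{s_k}` as an element of the algebra. -/
noncomputable def monom (R : Type*) {S : Type*} [CommRing R] (m : FreeMonoid S) : NCPoly R S :=
  MonoidAlgebra.single m 1

/-- The variable `t_s`. -/
noncomputable def var (R : Type*) {S : Type*} [CommRing R] (s : S) : NCPoly R S :=
  monom R (FreeMonoid.of s)

/-- The degree lexicographic order (strict) on monomials: first compare the degrees, then compare
lexicographically from the left. -/
def MonomLT [LT S] (m n : FreeMonoid S) : Prop :=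
  List.Shortlex (· < ·) (FreeMonoid.toList m) (FreeMonoid.toList n)

/-- `m` is the leading monomial of `f`: the largest monomial that occurs in `f` with nonzero
coefficient. The zero polynomial has none. -/
def IsLeadingMonomial [LT S] (f : NCPoly R S) (m : FreeMonoid S) : Prop :=
  m ∈ f.coeff.support ∧ ∀ n ∈ f.coeff.support, n ≠ m → MonomLT n m

/-- The leading terms (coefficient times leading monomial) of the nonzero elements of `F`. -/
def leadingTerms [LT S] (F : Set (NCPoly R S)) : Set (NCPoly R S) :=
  {p | ∃ f ∈ F, ∃ m, IsLeadingMonomial f m ∧ p = MonoidAlgebra.single m (f.coeff m)}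

/-- `G` is a Gröbner basis of the two-sided ideal `I` with respect to the degree lexicographic
order: `G ⊆ I`, and the leading terms of `G` and those of `I` generate the same two-sided
ideal. -/
def IsGroebnerBasis [LT S] (G : Set (NCPoly R S)) (I : TwoSidedIdeal (NCPoly R S)) : Prop :=
  (∀ g ∈ G, g ∈ I) ∧
    TwoSidedIdeal.span (leadingTerms G) = TwoSidedIdeal.span (leadingTerms {f | f ∈ I})

end Groebner

/-! ### The ideals `I_q(𝔐)` -/

section Ideal

variable {R S : Type*} [CommRing R] [LinearOrder S]

/-- The monomial `t_J = t_{j_1} ⋯ t_{j_k}` for `J = {j_1 < ⋯ < j_k}`. -/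
noncomputable def tset (R : Type*) {S : Type*} [CommRing R] [LinearOrder S] (J : Finset S) :
    NCPoly R S :=
  monom R (FreeMonoid.ofList (J.sort (· ≤ ·)))

/-- For `I = {j_{α_1} < ⋯ < j_{α_p}} ⊆ J = {j_1 < ⋯ < j_k}` this is `∑_ν (α_ν - ν)`: if
`i = j_{α_ν}`, then `α_ν` is the number of elements `≤ i` of `J`, and `ν` that of `I`. -/
def ell (J I : Finset S) : ℕ :=
  ∑ i ∈ I, ((J.filter (· ≤ i)).card - (I.filter (· ≤ i)).card)

/-- `t⁻_J = ∑ (-1)^{ℓ_J(I)} (-q)^{(#I-1)/2} t_{J∖I}`, over the subsets `I ⊆ J` of odd size. -/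
noncomputable def tminus (q : R) (J : Finset S) : NCPoly R S :=
  ∑ I ∈ J.powerset.filter (fun I => Odd I.card),
    ((-1 : R) ^ ell J I * (-q) ^ ((I.card - 1) / 2)) • tset R (J \ I)

/-- The generators `t_s² - q`, `t_r t_s + t_s t_r - 2q` (`s < r`), and `t⁻_J` (`J ∈ 𝔐`). -/
def generators (q : R) (𝔐 : Set (Finset S)) : Set (NCPoly R S) :=
  {f | ∃ s : S, f = var R s ^ 2 - algebraMap R (NCPoly R S) q} ∪
  {f | ∃ r s : S, s < r ∧
    f = var R r * var R s + var R s * var R r - algebraMap R (NCPoly R S) (2 * q)} ∪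
  {f | ∃ J ∈ 𝔐, f = tminus q J}

/-- The two-sided ideal `I_q(𝔐)`. For `q = 0` and `𝔐` the set of circuits of a simple matroid it
is the defining ideal of the Orlik–Solomon algebra. -/
noncomputable def definingIdeal (q : R) (𝔐 : Set (Finset S)) : TwoSidedIdeal (NCPoly R S) :=
  TwoSidedIdeal.span (generators q 𝔐)

/-- The boundary `∑_{ν=1}^{#J} (-1)^{ν-1} t_{J∖{j_ν}}` of `J = {j_1 < ⋯ < j_{#J}}`; the index `ν`
of the code is one less than that of the formula. -/
noncomputable def boundary (R : Type*) {S : Type*} [CommRing R] [LinearOrder S] (J : Finset S) :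
    NCPoly R S :=
  ∑ ν : Fin J.card, (-1 : R) ^ (ν : ℕ) • tset R (J.erase (J.orderEmbOfFin rfl ν))

end Ideal

/-! ### Gröbner circuits -/

section Circuits

variable {S : Type*} [LinearOrder S]

/-- The degree lexicographic order (strict) on subsets of `S`, induced by that on the monomials
`t_J`. -/
def FinsetLT (J K : Finset S) : Prop :=
  MonomLT (FreeMonoid.ofList (J.sort (· ≤ ·))) (FreeMonoid.ofList (K.sort (· ≤ ·)))

theorem finsetLT_wf [Finite S] : WellFounded (FinsetLT (S := S)) :=
  InvImage.wf (fun J : Finset S => J.sort (· ≤ ·)) (List.Shortlex.wf wellFounded_lt)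

/-- `K` is a convex subset of `J`. -/
def IsConvexSubset (K J : Finset S) : Prop :=
  K ⊆ J ∧ ∀ j ∈ J, ∀ k ∈ K, ∀ k' ∈ K, k < j → j < k' → j ∈ K

/-- `J ∖ {j_1}`: the set `J` without its least element. -/
def dropMin (J : Finset S) : Finset S :=
  J.filter (fun j => ∃ i ∈ J, i < j)

/-- `J` is dependent: it contains a member of `𝔐`. -/
def IsDependent (𝔐 : Set (Finset S)) (J : Finset S) : Prop :=
  ∃ C ∈ 𝔐, C ⊆ J

/-- Gröbner circuits, by recursion along the degree lexicographic order; the recursive condition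
itself is `mem_groebnerCircuits`. -/
def IsGroebnerCircuit [Finite S] (𝔐 : Set (Finset S)) : Finset S → Prop :=
  finsetLT_wf.fix fun J rec =>
    IsDependent 𝔐 J ∧
      ∀ (K : Finset S) (h : FinsetLT K J), rec K h → ¬ IsConvexSubset (dropMin K) (dropMin J)

/-- The set of Gröbner circuits of `𝔐`. -/
def groebnerCircuits [Finite S] (𝔐 : Set (Finset S)) : Set (Finset S) :=
  {J | IsGroebnerCircuit 𝔐 J}

/-- The defining condition of Gröbner circuits: a set `J` is one if and only if it is dependent and
there is no Gröbner circuit `K`, smaller than `J` in the degree lexicographic order, such that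
`K ∖ {k_1}` is a convex subset of `J ∖ {j_1}`. -/
theorem mem_groebnerCircuits [Finite S] (𝔐 : Set (Finset S)) (J : Finset S) :
    J ∈ groebnerCircuits 𝔐 ↔ IsDependent 𝔐 J ∧
      ∀ K ∈ groebnerCircuits 𝔐, FinsetLT K J → ¬ IsConvexSubset (dropMin K) (dropMin J) := by
  have h : IsGroebnerCircuit 𝔐 J ↔ IsDependent 𝔐 J ∧ ∀ K, FinsetLT K J →
      IsGroebnerCircuit 𝔐 K → ¬ IsConvexSubset (dropMin K) (dropMin J) := by
    unfold IsGroebnerCircuit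
    rw [WellFounded.fix_eq]
  exact h.trans (and_congr_right fun _ => forall_congr' fun _ => forall_comm)

/-- The set of circuits of a matroid on `S`. -/
def circuits (M : Matroid S) : Set (Finset S) :=
  {C | M.IsCircuit (C : Set S)}

end Circuits

end OrlikSolomon

/-! The proposed elements lie in the ideal: modulo it the variables square to zero and anticommute,
so the boundary obeys a graded Leibniz rule, and the boundary of a dependent set dies because that
of a circuit inside it does (`boundary_mem_definingIdeal`).

It remains to divide the leading monomial `m` of any nonzero `f` in the ideal by a leading monomial
of the basis. If `m` is not strictly increasing, it contains a factor `t_b²` or `t_a t_b` with `b <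
a`. If `m` is increasing and contains a broken circuit (a circuit minus its minimum), then some
Gröbner circuit `K` has `dropMin K` convex in `m`; this makes `t_{dropMin K}`, the leading monomial
of its boundary, a factor of `m` (`exists_groebnerCircuit`, `IsConvexSubset.sort_isInfix`).

The remaining case, `m` increasing without broken circuits, cannot occur. Label each `s` by the set
of flats containing it in the flag spanned by the final segments of `m`, and send `t_s` to the basis
vector of its label in an exterior algebra. Every circuit repeats a label, so the ideal maps to
zero. The coefficient of the wedge of the labels of `m` is 1 on `m` and 0 on every smaller monomial,
so on `f` it would be the leading coefficient (`not_isLeadingMonomial_of_forall_not_subset`). -/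

namespace OrlikSolomon

/-! ### Boundaries of words in a ring. -/

section WordBoundary

/-- The alternating sum of the products obtained from `x a₁ ⋯ x aₖ` by omitting one factor. -/
def wordBoundary {A S : Type*} [Ring A] (x : S → A) : List S → A
  | [] => 0
  | a :: l => (l.map x).prod - x a * wordBoundary x l

variable {A S : Type*} [Ring A] (x : S → A)

theorem wordBoundary_eq_sum (l : List S) :
    wordBoundary x l = ∑ i : Fin l.length, (-1) ^ (i : ℕ) * ((l.eraseIdx i).map x).prod := by
  induction l with
  | nil => simp [wordBoundary]
  | cons a l ih =>
    simp only [List.length_cons]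
    rw [wordBoundary, ih, Fin.sum_univ_succ, sub_eq_add_neg, Finset.mul_sum,
      ← Finset.sum_neg_distrib]
    simp only [Fin.val_zero, pow_zero, one_mul, List.eraseIdx_cons_zero, Fin.val_succ,
      List.eraseIdx_cons_succ, List.map_cons, List.prod_cons, pow_succ]
    refine congrArg _ (Finset.sum_congr rfl fun i _ => ?_)
    rw [← mul_assoc, ← ((Commute.neg_one_left (x a)).pow_left i).eq]
    simp [mul_assoc]

theorem map_wordBoundary {B : Type*} [Ring B] (φ : A →+* B) (l : List S) :
    φ (wordBoundary x l) = wordBoundary (fun s => φ (x s)) l := by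
  induction l with
  | nil => simp [wordBoundary]
  | cons a l ih => simp [wordBoundary, ih, map_list_prod, Function.comp_def]

/-- The graded Leibniz rule for the boundary. -/
theorem wordBoundary_append (l l' : List S) :
    wordBoundary x (l ++ l') = wordBoundary x l * (l'.map x).prod +
      (-1) ^ l.length * (l.map x).prod * wordBoundary x l' := by
  induction l with
  | nil => simp [wordBoundary]
  | cons a l ih =>
    have h : x a * (-1) ^ l.length = (-1) ^ l.length * x a :=
      ((Commute.neg_one_right (x a)).pow_right _).eq
    simp only [List.cons_append, wordBoundary, ih, List.map_append, List.prod_append,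
      List.map_cons, List.prod_cons, List.length_cons, pow_succ, mul_add, sub_mul, mul_neg,
      mul_one, neg_mul]
    rw [← mul_assoc, ← mul_assoc, ← mul_assoc, ← mul_assoc, h]
    abel

variable {x}

/-- Rearranging the factors changes a product of anticommuting elements and its boundary by a
common sign. -/
theorem prod_and_wordBoundary_of_perm (hx : ∀ r s, x r * x s = -(x s * x r)) {l l' : List S}
    (h : l.Perm l') :
    ((l'.map x).prod = (l.map x).prod ∧ wordBoundary x l' = wordBoundary x l) ∨
      ((l'.map x).prod = -(l.map x).prod ∧ wordBoundary x l' = -wordBoundary x l) := by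
  induction h with
  | nil => simp
  | cons a _ ih =>
    rcases ih with ⟨h1, h2⟩ | ⟨h1, h2⟩
    · left; simp [wordBoundary, h1, h2]
    · right
      simp [wordBoundary, h1, h2]
      abel
  | swap a b l =>
    right
    simp only [List.map_cons, List.prod_cons, wordBoundary, mul_sub, ← mul_assoc]
    rw [hx a b]
    exact ⟨by simp, by simp; abel⟩
  | trans _ _ ih1 ih2 =>
    rcases ih1 with ⟨h1, h2⟩ | ⟨h1, h2⟩ <;> rcases ih2 with ⟨h3, h4⟩ | ⟨h3, h4⟩ <;>
      simp [h1, h2, h3, h4]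

/-- Up to sign, the letters of `c` can be moved to the front of `l`. By the Leibniz rule it then
suffices that both the boundary and the product of `c` vanish. -/
theorem wordBoundary_eq_zero_of_subset [DecidableEq S] (hsq : ∀ s, x s * x s = 0)
    (hx : ∀ r s, x r * x s = -(x s * x r)) {c l : List S} (hc : c ≠ []) (hcn : c.Nodup)
    (hsub : c ⊆ l) (h : wordBoundary x c = 0) : wordBoundary x l = 0 := by
  have hp : (c.map x).prod = 0 := by
    cases c with
    | nil => exact absurd rfl hc
    | cons a c =>
      -- Since `x a` squares to zero, multiplying the boundary of `a :: c` by `x a` gives back the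
      -- full product.
      have := congrArg (x a * ·) h
      simpa [wordBoundary, mul_sub, ← mul_assoc, hsq] using this
  obtain ⟨d, hd, hdl⟩ := hcn.subperm hsub
  obtain ⟨e, he⟩ := hdl.exists_perm_append
  have hperm : (c ++ e).Perm l := (hd.symm.append_right e).trans he.symm
  have h0 : wordBoundary x (c ++ e) = 0 := by simp [wordBoundary_append, h, hp]
  rcases prod_and_wordBoundary_of_perm hx hperm with h1 | h1 <;> simp [h1.2, h0]

end WordBoundary

/-! ### The generators at `q = 0` and boundaries of dependent sets. -/

section Boundary

variable {R S : Type*} [CommRing R]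

theorem monom_ofList (l : List S) :
    monom R (FreeMonoid.ofList l) = (l.map (var R)).prod := by
  induction l with
  | nil => rfl
  | cons a l ih =>
    rw [List.map_cons, List.prod_cons, ← ih, var, monom, monom, monom,
      MonoidAlgebra.single_mul_single, FreeMonoid.ofList_cons, one_mul]

variable [LinearOrder S]

theorem sort_erase_orderEmbOfFin (J : Finset S) (i : Fin J.card) :
    (J.erase (J.orderEmbOfFin rfl i)).sort (· ≤ ·) = (J.sort (· ≤ ·)).eraseIdx i := by
  have hnd := J.sort_nodup (· ≤ ·)
  have hi : (i : ℕ) < (J.sort (· ≤ ·)).length := by simp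
  have h1 : (J.sort (· ≤ ·)).eraseIdx i = (J.sort (· ≤ ·)).erase (J.orderEmbOfFin rfl i) := by
    rw [Finset.orderEmbOfFin_apply]
    exact (hnd.erase_getElem i hi).symm
  have h2 : J.erase (J.orderEmbOfFin rfl i) = ((J.sort (· ≤ ·)).eraseIdx i).toFinset := by
    rw [h1]
    ext a
    simp [hnd.mem_erase_iff]
  rw [h2, List.toFinset_sort _ (hnd.sublist (List.eraseIdx_sublist _ _))]
  exact (J.pairwise_sort (· ≤ ·)).sublist (List.eraseIdx_sublist _ _)

theorem boundary_eq_sum (J : Finset S) :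
    boundary R J = ∑ i : Fin J.card, (-1 : R) ^ (i : ℕ) •
      monom R (FreeMonoid.ofList ((J.sort (· ≤ ·)).eraseIdx i)) := by
  refine Finset.sum_congr rfl fun i _ => ?_
  rw [tset, sort_erase_orderEmbOfFin]

theorem boundary_eq_wordBoundary (J : Finset S) :
    boundary R J = wordBoundary (var R) (J.sort (· ≤ ·)) := by
  rw [wordBoundary_eq_sum, boundary_eq_sum]
  refine Fintype.sum_equiv (finCongr (by simp)) _ _ fun i => ?_
  rw [monom_ofList, Algebra.smul_def, map_pow, map_neg, map_one]
  rfl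

theorem card_filter_le_orderEmbOfFin (J : Finset S) (i : Fin J.card) :
    (J.filter (· ≤ J.orderEmbOfFin rfl i)).card = i + 1 := by
  have : J.filter (· ≤ J.orderEmbOfFin rfl i) =
      (Finset.Iic i).map (J.orderEmbOfFin rfl).toEmbedding := by
    ext a
    simp only [Finset.mem_filter, Finset.mem_map, Finset.mem_Iic, RelEmbedding.coe_toEmbedding]
    constructor
    · rintro ⟨ha, hle⟩
      obtain ⟨j, rfl⟩ : a ∈ Set.range (J.orderEmbOfFin rfl) := by simpa using ha
      exact ⟨j, (J.orderEmbOfFin rfl).le_iff_le.1 hle, rfl⟩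
    · rintro ⟨j, hj, rfl⟩
      exact ⟨J.orderEmbOfFin_mem rfl j, (J.orderEmbOfFin rfl).le_iff_le.2 hj⟩
  rw [this, Finset.card_map, Fin.card_Iic]

/-- At `q = 0` only the singletons `I` survive, and `ell` of a singleton is its position in `J`
counted from zero. -/
theorem tminus_zero (J : Finset S) : tminus (0 : R) J = boundary R J := by
  have hinj : Function.Injective fun i : Fin J.card => ({J.orderEmbOfFin rfl i} : Finset S) :=
    fun i j h => by simpa using h
  have hsub : Finset.univ.image (fun i : Fin J.card => ({J.orderEmbOfFin rfl i} : Finset S)) ⊆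
      J.powerset.filter (fun I => Odd I.card) := by
    intro I hI
    obtain ⟨i, -, rfl⟩ := Finset.mem_image.1 hI
    simp
  rw [tminus, ← Finset.sum_subset hsub, Finset.sum_image fun i _ j _ h => hinj h]
  · refine Finset.sum_congr rfl fun i _ => ?_
    have hell : ell J {J.orderEmbOfFin rfl i} = i := by
      rw [ell, Finset.sum_singleton, card_filter_le_orderEmbOfFin]
      simp [Finset.filter_singleton]
    rw [hell, Finset.sdiff_singleton_eq_erase]
    simp
  · intro I hI hI'
    obtain ⟨hIJ, hodd⟩ := Finset.mem_filter.1 hI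
    have hcard : I.card ≠ 1 := by
      intro h1
      obtain ⟨a, rfl⟩ := Finset.card_eq_one.1 h1
      obtain ⟨i, rfl⟩ : a ∈ Set.range (J.orderEmbOfFin rfl) := by
        simpa using hIJ
      exact hI' (Finset.mem_image.2 ⟨i, Finset.mem_univ _, rfl⟩)
    obtain ⟨k, hk⟩ := hodd
    have hk0 : (I.card - 1) / 2 ≠ 0 := by omega
    simp [hk0]

/-- The boundary of a dependent set lies in the defining ideal. -/
theorem boundary_mem_definingIdeal {𝔐 : Set (Finset S)} (h𝔐 : ∅ ∉ 𝔐) {J : Finset S}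
    (hJ : IsDependent 𝔐 J) : boundary R J ∈ definingIdeal (0 : R) 𝔐 := by
  obtain ⟨C, hC, hCJ⟩ := hJ
  set I := definingIdeal (0 : R) 𝔐
  let φ := I.ringCon.mk'
  have hφ : ∀ {f}, f ∈ I ↔ φ f = 0 := fun {f} => by
    rw [← TwoSidedIdeal.mem_ker, TwoSidedIdeal.ker_ringCon_mk']
  have hgen : ∀ f ∈ generators (0 : R) 𝔐, φ f = 0 := fun f hf =>
    hφ.1 (TwoSidedIdeal.subset_span hf)
  have hsq : ∀ s, φ (var R s) * φ (var R s) = 0 := fun s => by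
    simpa [sq] using hgen _ (.inl (.inl ⟨s, rfl⟩))
  have hlt : ∀ r s : S, s < r → φ (var R r) * φ (var R s) + φ (var R s) * φ (var R r) = 0 :=
    fun r s h => by simpa using hgen _ (.inl (.inr ⟨r, s, h, rfl⟩))
  have hanti : ∀ r s, φ (var R r) * φ (var R s) = -(φ (var R s) * φ (var R r)) := fun r s => by
    rcases lt_trichotomy r s with h | rfl | h
    · exact eq_neg_of_add_eq_zero_right (hlt s r h)
    · simp [hsq]
    · exact eq_neg_of_add_eq_zero_left (hlt r s h)
  have hC0 : φ (boundary R C) = 0 := by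
    rw [← tminus_zero]
    exact hgen _ (.inr ⟨C, hC, rfl⟩)
  rw [boundary_eq_wordBoundary, map_wordBoundary] at hC0
  rw [hφ, boundary_eq_wordBoundary, map_wordBoundary]
  refine wordBoundary_eq_zero_of_subset hsq hanti ?_ (C.sort_nodup _) ?_ hC0
  · intro h
    have : C = ∅ := by rw [← C.sort_toFinset (· ≤ ·), h]; rfl
    exact h𝔐 (this ▸ hC)
  · intro a ha
    simpa using hCJ (by simpa using ha)

end Boundary

end OrlikSolomon

namespace OrlikSolomon

/-! ### Homomorphisms to exterior algebras given by labels. -/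

section Labelling

open CliffordAlgebra in
-- Contraction is an antiderivation, so it satisfies the recursion of the boundary. Consequently a
-- vanishing product in the exterior algebra has vanishing boundary.
theorem contractLeft_prod_map_ι {R S V : Type*} [CommRing R] [AddCommGroup V] [Module R V]
    (d : Module.Dual R V) (v : S → V) (hd : ∀ s, d (v s) = 1) (l : List S) :
    contractLeft (Q := (0 : QuadraticForm R V)) d
      (l.map fun s => ExteriorAlgebra.ι R (v s)).prod =
        wordBoundary (fun s => ExteriorAlgebra.ι R (v s)) l := by
  induction l with
  | nil => simp only [List.map_nil, List.prod_nil, wordBoundary]; exact contractLeft_one (Q := 0) d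
  | cons a l ih =>
    rw [List.map_cons, List.prod_cons, wordBoundary, ← ih]
    refine (contractLeft_ι_mul d (v a) _).trans ?_
    rw [hd, one_smul]

theorem prod_map_ι_eq_ιMulti {R S V : Type*} [CommRing R] [AddCommGroup V] [Module R V]
    (v : S → V) (l : List S) :
    (l.map fun s => ExteriorAlgebra.ι R (v s)).prod =
      ExteriorAlgebra.ιMulti R l.length fun i => v l[i] := by
  rw [ExteriorAlgebra.ιMulti_apply]
  congr 1
  exact List.ext_getElem (by simp) (by simp)

variable (R : Type*) {S κ : Type*} [CommRing R]

/-- The homomorphism to the exterior algebra on the set of labels that sends each variable to its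
label. -/
noncomputable def labelHom (f : S → κ) : NCPoly R S →ₐ[R] ExteriorAlgebra R (κ →₀ R) :=
  MonoidAlgebra.lift R _ _
    (FreeMonoid.lift fun s => ExteriorAlgebra.ι R (Finsupp.single (f s) (1 : R)))

/-- The coefficient of the wedge product of the basis vectors `b₁, …, bₖ`. -/
noncomputable def wedgeCoeff {k : ℕ} (b : Fin k → κ) : ExteriorAlgebra R (κ →₀ R) →ₗ[R] R :=
  ExteriorAlgebra.liftAlternating (Pi.single k
    (Matrix.detRowAlternating.compLinearMap (LinearMap.pi fun j => Finsupp.lapply (b j))))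

variable {R}

theorem labelHom_var (f : S → κ) (s : S) :
    labelHom R f (var R s) = ExteriorAlgebra.ι R (Finsupp.single (f s) 1) := by
  simp [labelHom, var, monom]

theorem labelHom_single (f : S → κ) (l : List S) (c : R) :
    labelHom R f (MonoidAlgebra.single (FreeMonoid.ofList l) c) =
      c • ExteriorAlgebra.ιMulti R l.length fun i => Finsupp.single (f l[i]) 1 := by
  rw [← prod_map_ι_eq_ιMulti (fun s => Finsupp.single (f s) (1 : R)), labelHom,
    MonoidAlgebra.lift_single, FreeMonoid.lift_apply, FreeMonoid.toList_ofList]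

theorem wedgeCoeff_ιMulti [DecidableEq κ] {k : ℕ} (b c : Fin k → κ) :
    wedgeCoeff R b (ExteriorAlgebra.ιMulti R k fun i => Finsupp.single (c i) 1) =
      (Matrix.of fun i j => if c i = b j then (1 : R) else 0).det := by
  rw [wedgeCoeff, ExteriorAlgebra.liftAlternating_apply_ιMulti, Pi.single_eq_same]
  simp only [AlternatingMap.compLinearMap_apply]
  congr 1
  ext i j
  simp [Finsupp.single_apply]

theorem wedgeCoeff_ιMulti_of_ne {k n : ℕ} (h : n ≠ k) (b : Fin k → κ) (v : Fin n → κ →₀ R) :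
    wedgeCoeff R b (ExteriorAlgebra.ιMulti R n v) = 0 := by
  rw [wedgeCoeff, ExteriorAlgebra.liftAlternating_apply_ιMulti, Pi.single_eq_of_ne h]
  rfl

theorem wedgeCoeff_ιMulti_of_forall_ne {k n : ℕ} (b : Fin k → κ) (c : Fin n → κ) (i : Fin n)
    (hi : ∀ j, c i ≠ b j) :
    wedgeCoeff R b (ExteriorAlgebra.ιMulti R n fun i => Finsupp.single (c i) 1) = 0 := by
  classical
  by_cases h : n = k
  · subst h
    rw [wedgeCoeff_ιMulti]
    exact Matrix.det_eq_zero_of_row_eq_zero i fun j => by simp [hi j]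
  · exact wedgeCoeff_ιMulti_of_ne h b _

/-- If each member of `𝔐` has two elements with the same label, then the labelling kills the
defining ideal. -/
theorem labelHom_eq_zero [LinearOrder S] {𝔐 : Set (Finset S)} {f : S → κ}
    (hf : ∀ C ∈ 𝔐, ∃ a ∈ C, ∃ b ∈ C, a ≠ b ∧ f a = f b) {p : NCPoly R S}
    (hp : p ∈ definingIdeal (0 : R) 𝔐) : labelHom R f p = 0 := by
  rw [← TwoSidedIdeal.mem_ker]
  refine (TwoSidedIdeal.span_le (I := TwoSidedIdeal.ker (labelHom R f))).2 ?_ hp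
  rintro p ((⟨s, rfl⟩ | ⟨r, s, -, rfl⟩) | ⟨C, hC, rfl⟩)
  · rw [SetLike.mem_coe, TwoSidedIdeal.mem_ker]
    simp [labelHom_var, sq]
  · rw [SetLike.mem_coe, TwoSidedIdeal.mem_ker]
    simp [labelHom_var, ExteriorAlgebra.ι_add_mul_swap]
  · rw [SetLike.mem_coe, TwoSidedIdeal.mem_ker, tminus_zero, boundary_eq_wordBoundary]
    refine (map_wordBoundary (var R) (labelHom R f).toRingHom _).trans ?_
    simp only [AlgHom.toRingHom_eq_coe, RingHom.coe_coe, labelHom_var]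
    -- The sum of coordinates takes the value 1 on every basis vector.
    rw [← contractLeft_prod_map_ι (Finsupp.linearCombination R fun _ => (1 : R)) _ (by simp),
      prod_map_ι_eq_ιMulti]
    obtain ⟨a, ha, b, hb, hab, hfab⟩ := hf C hC
    obtain ⟨i, hi, rfl⟩ := List.getElem_of_mem ((C.mem_sort (· ≤ ·)).2 ha)
    obtain ⟨j, hj, rfl⟩ := List.getElem_of_mem ((C.mem_sort (· ≤ ·)).2 hb)
    rw [AlternatingMap.map_eq_zero_of_eq (i := ⟨i, hi⟩) (j := ⟨j, hj⟩), map_zero]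
    · simp [hfab]
    · rintro h
      simp only [Fin.mk.injEq] at h
      subst h
      exact hab rfl

end Labelling

/-! ### Flags of flats and monomials without broken circuits. -/

section BrokenCircuits

variable {S : Type*} {M : Matroid S}

theorem mem_circuits {C : Finset S} : C ∈ circuits M ↔ M.IsCircuit (C : Set S) := Iff.rfl

/-- The flats spanned by the final segments of `l` that contain `s`, by starting index. -/
def flagLabel (M : Matroid S) (l : List S) (s : S) : Set ℕ :=
  {i | s ∈ M.closure {a | a ∈ l.drop i}}

/-- A circuit has two elements which lie in the same members of the flag. -/
theorem exists_flagLabel_eq [M.Loopless] (l : List S) {C : Finset S}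
    (hC : C ∈ circuits M) :
    ∃ a ∈ C, ∃ b ∈ C, a ≠ b ∧ flagLabel M l a = flagLabel M l b := by
  classical
  have hCc : M.IsCircuit (C : Set S) := hC
  have hex : ∃ i, ¬ (C : Set S) ⊆ M.closure {a | a ∈ l.drop i} := by
    -- The last flat is the closure of the empty set, which is empty as there are no loops.
    refine ⟨l.length, fun h => ?_⟩
    obtain ⟨a, ha⟩ := hCc.nonempty
    have := h ha
    simp [M.closure_empty] at this
  have hmin : ∀ i < Nat.find hex, (C : Set S) ⊆ M.closure {a | a ∈ l.drop i} := fun i hi =>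
    not_not.1 (Nat.find_min hex hi)
  have hanti : ∀ {i j : ℕ}, i ≤ j →
      M.closure {a | a ∈ l.drop j} ⊆ M.closure {a | a ∈ l.drop i} := fun hij =>
    M.closure_subset_closure fun a ha => List.drop_subset_drop_left l hij ha
  obtain ⟨a, ha, ha'⟩ := Set.not_subset.1 (Nat.find_spec hex)
  -- A circuit cannot have exactly one element outside a flat. Two elements outside the first flat
  -- not containing `C` lie in precisely the earlier ones.
  obtain ⟨b, hb, hb', hba⟩ : ∃ b ∈ (C : Set S),
      b ∉ M.closure {a | a ∈ l.drop (Nat.find hex)} ∧ b ≠ a := by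
    by_contra! h
    refine ha' (M.closure_subset_closure_of_subset_closure ?_
      (hCc.mem_closure_sdiff_singleton_of_mem ha))
    rintro b ⟨hb, hba⟩
    exact not_not.1 fun hb' => hba (h b hb hb')
  refine ⟨a, ha, b, hb, hba.symm, Set.ext fun i => ?_⟩
  rcases lt_or_ge i (Nat.find hex) with hi | hi
  · exact iff_of_true (hmin i hi ha) (hmin i hi hb)
  · exact iff_of_false (fun h => ha' (hanti hi h)) (fun h => hb' (hanti hi h))

variable [LinearOrder S]

/-- Otherwise `s` closes a circuit inside `X ∪ {s}`. Its broken circuit lies in `B`, either because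
`s` does or because `s` is the minimum that is dropped. -/
theorem notMem_closure_of_forall_lt [Finite S] {B : Set S}
    (hB : ∀ C ∈ circuits M, ¬ (dropMin C : Set S) ⊆ B) {X : Set S} (hX : X ⊆ B) {s : S}
    (hs : s ∉ X) (h : s ∈ B ∨ ∀ a ∈ X, s < a) : s ∉ M.closure X := by
  intro hcl
  obtain ⟨C, hCX, hC, hsC⟩ := M.exists_isCircuit_of_mem_closure hcl hs
  have hC' : C.toFinite.toFinset ∈ circuits M := by simpa [mem_circuits] using hC
  refine hB _ hC' fun a ha => ?_
  simp only [dropMin, Finset.coe_filter, Set.Finite.mem_toFinset, Set.mem_ofPred_eq] at ha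
  obtain ⟨haC, i, hiC, hia⟩ := ha
  rcases hCX haC with rfl | haX
  · rcases h with h | h
    · exact h
    · rcases hCX hiC with rfl | hiX
      · exact absurd hia (lt_irrefl _)
      · exact absurd hia (h i hiX).asymm
  · exact hX haX

/-- The leading monomial of an element of the defining ideal is not an increasing monomial without
broken circuits. -/
theorem not_isLeadingMonomial_of_forall_not_subset {R : Type*} [CommRing R] [Finite S]
    [M.Loopless] (hE : M.E = Set.univ) {l : List S} (hl : l.Pairwise (· < ·))
    (hB : ∀ C ∈ circuits M, ¬ (dropMin C : Set S) ⊆ {a | a ∈ l}) {p : NCPoly R S}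
    (hp : p ∈ definingIdeal (0 : R) (circuits M)) :
    ¬ IsLeadingMonomial p (FreeMonoid.ofList l) := by
  classical
  rintro ⟨hmem, hmax⟩
  have hdrop : ∀ j, {a | a ∈ l.drop j} ⊆ {a | a ∈ l} := fun j a ha => List.mem_of_mem_drop ha
  have hmem_label : ∀ (j : ℕ) (hj : j < l.length), ∀ i ≤ j, i ∈ flagLabel M l l[j] := by
    intro j hj i hij
    refine M.mem_closure_of_mem' ?_ (by simp [hE])
    rw [Set.mem_ofPred_eq, List.mem_drop_iff_getElem]
    exact ⟨j - i, by omega, by simp [show i + (j - i) = j by omega]⟩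
  have hlt_drop : ∀ (j : ℕ) (hj : j < l.length), ∀ i > j, ∀ a ∈ l.drop i, l[j] < a := by
    intro j hj i hij a ha
    obtain ⟨k, hk, rfl⟩ := List.mem_drop_iff_getElem.1 ha
    exact List.pairwise_iff_getElem.1 hl _ _ hj _ (by omega)
  have hnot_label : ∀ (j : ℕ) (hj : j < l.length), ∀ i > j, i ∉ flagLabel M l l[j] := by
    intro j hj i hij
    exact notMem_closure_of_forall_lt hB (hdrop i)
      (fun h => lt_irrefl _ (hlt_drop j hj i hij _ h)) (.inl (List.getElem_mem hj))
  have hinj : ∀ i j : Fin l.length, flagLabel M l l[i] = flagLabel M l l[j] → i = j := by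
    intro i j h
    by_contra hij
    rcases lt_or_gt_of_ne hij with hij | hij
    · exact hnot_label i i.2 j hij (h ▸ hmem_label j j.2 j le_rfl)
    · exact hnot_label j j.2 i hij (h ▸ hmem_label i i.2 i le_rfl)
  let Λ := wedgeCoeff R fun i : Fin l.length => flagLabel M l l[i]
  have hlead : Λ (labelHom R (flagLabel M l)
      (MonoidAlgebra.single (FreeMonoid.ofList l) (p.coeff (FreeMonoid.ofList l)))) =
        p.coeff (FreeMonoid.ofList l) := by
    rw [labelHom_single, map_smul, wedgeCoeff_ιMulti]
    have : (Matrix.of fun i j : Fin l.length =>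
        if flagLabel M l l[i] = flagLabel M l l[j] then (1 : R) else 0) = 1 := by
      ext i j
      rw [Matrix.of_apply, Matrix.one_apply]
      exact if_congr ⟨hinj i j, fun h => by rw [h]⟩ rfl rfl
    rw [this, Matrix.det_one, smul_eq_mul, mul_one]
  have hother : ∀ n ∈ p.coeff.support, n ≠ FreeMonoid.ofList l →
      Λ (labelHom R (flagLabel M l) (MonoidAlgebra.single n (p.coeff n))) = 0 := by
    intro n hn hne
    obtain ⟨w, rfl⟩ := FreeMonoid.ofList.surjective n
    rw [labelHom_single, map_smul]
    rcases List.shortlex_def.1 (hmax _ hn hne) with hlen | ⟨hlen, hlex⟩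
    · rw [wedgeCoeff_ιMulti_of_ne (by simpa using hlen.ne), smul_zero]
    · replace hlen : w.length = l.length := hlen
      replace hlex : List.Lex (· < ·) w l := hlex
      obtain ⟨h, hwh, hlh, hpre, hlt⟩ : ∃ (h : ℕ) (hw : h < w.length) (hl : h < l.length),
          (∀ (j : ℕ) (hj : j < h), w[j] = l[j]) ∧ w[h] < l[h] := by
        rcases List.lt_iff_exists.1 hlex with ⟨-, h⟩ | ⟨i, hw, hl, hpre, hlt⟩
        · exact absurd hlen h.ne
        · exact ⟨i, hw, hl, hpre, hlt⟩
      -- The label of `l[j]` contains `h`. If `w[h]` shared it, `w[h]` would lie in the span of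
      -- `l.drop h`, all of whose elements are larger.
      have hlabel : ∀ (j : ℕ) (hj : j < l.length), h ≤ j →
          flagLabel M l w[h] ≠ flagLabel M l l[j] := by
        intro j hj hhj heq
        have hlt' : ∀ a ∈ l.drop h, w[h] < a := by
          intro a ha
          obtain ⟨k, hk, rfl⟩ := List.mem_drop_iff_getElem.1 ha
          refine hlt.trans_le ?_
          rcases Nat.eq_zero_or_pos k with rfl | hk0
          · simp
          · exact (List.pairwise_iff_getElem.1 hl _ _ hlh _ (by omega)).le
        refine notMem_closure_of_forall_lt hB (hdrop h) (fun h' => lt_irrefl _ (hlt' _ h'))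
          (.inr hlt') ?_
        exact heq.ge (hmem_label j hj h hhj)
      -- Either the label of `w[h]` repeats that of `w[j] = l[j]` for an earlier `j` and the wedge
      -- is zero, or it is not a label of `l` at all and the determinant has a zero row.
      by_cases hex : ∃ j, ∃ (hj : j < h), flagLabel M l w[h] = flagLabel M l l[j]
      · obtain ⟨j, hj, hjl⟩ := hex
        rw [AlternatingMap.map_eq_zero_of_eq (i := ⟨h, hwh⟩) (j := ⟨j, hj.trans hwh⟩),
          map_zero, smul_zero]
        · simp only [Fin.getElem_fin, hjl, ← hpre j hj]
        · simpa using hj.ne'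
      · rw [wedgeCoeff_ιMulti_of_forall_ne (fun i : Fin l.length => flagLabel M l l[i])
          (fun i : Fin w.length => flagLabel M l w[i]) ⟨h, hwh⟩, smul_zero]
        intro j
        rcases lt_or_ge (j : ℕ) h with hj | hj
        · exact fun heq => hex ⟨j, hj, heq⟩
        · exact hlabel j j.2 hj
  have hsum : Λ (labelHom R (flagLabel M l) p) = p.coeff (FreeMonoid.ofList l) := by
    conv_lhs => rw [← MonoidAlgebra.sum_coeff_single p, Finsupp.sum, map_sum, map_sum]
    rw [Finset.sum_eq_single_of_mem _ hmem hother, hlead]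
  rw [labelHom_eq_zero (fun C hC => exists_flagLabel_eq l hC) hp, map_zero] at hsum
  exact Finsupp.mem_support_iff.1 hmem hsum.symm

end BrokenCircuits

end OrlikSolomon

namespace OrlikSolomon

/-! ### Gröbner circuits and convex subsets. -/

section GroebnerCircuits

variable {S : Type*} [LinearOrder S]

theorem mem_dropMin {J : Finset S} {j : S} : j ∈ dropMin J ↔ j ∈ J ∧ ∃ i ∈ J, i < j := by
  simp [dropMin]

theorem IsConvexSubset.trans {K J I : Finset S} (h : IsConvexSubset K J)
    (h' : IsConvexSubset J I) : IsConvexSubset K I :=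
  ⟨h.1.trans h'.1, fun j hj k hk k' hk' hkj hjk' =>
    h.2 j (h'.2 j hj k (h.1 hk) k' (h.1 hk') hkj hjk') k hk k' hk' hkj hjk'⟩

/-- If a set contains a broken circuit, then some Gröbner circuit without its least element is a
convex subset. -/
theorem exists_groebnerCircuit [Finite S] {𝔐 : Set (Finset S)} {C I : Finset S} (hC : C ∈ 𝔐)
    (hne : C.Nonempty) (hCI : dropMin C ⊆ I) :
    ∃ K ∈ groebnerCircuits 𝔐, IsConvexSubset (dropMin K) I := by
  set c := C.min' hne
  -- `J` contains `C`, and without its minimum it is a final segment of `I`, hence convex.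
  let J := insert c (I.filter (c < ·))
  have hJ : dropMin J = I.filter (c < ·) := by
    ext j
    simp only [J, mem_dropMin, Finset.mem_insert, Finset.mem_filter]
    constructor
    · rintro ⟨rfl | hj, i, rfl | hi, hij⟩
      · exact absurd hij (lt_irrefl _)
      · exact absurd hij hi.2.asymm
      · exact hj
      · exact hj
    · exact fun hj => ⟨.inr hj, c, .inl rfl, hj.2⟩
  have hJI : IsConvexSubset (dropMin J) I := by
    rw [hJ]
    refine ⟨Finset.filter_subset _ _, fun j hj k hk _ _ hkj _ => ?_⟩
    exact Finset.mem_filter.2 ⟨hj, (Finset.mem_filter.1 hk).2.trans hkj⟩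
  have hdep : IsDependent 𝔐 J := by
    refine ⟨C, hC, fun a ha => ?_⟩
    rcases (C.min'_le a ha).eq_or_lt with h | h
    · exact Finset.mem_insert.2 (.inl h.symm)
    · exact Finset.mem_insert_of_mem (Finset.mem_filter.2
        ⟨hCI (mem_dropMin.2 ⟨ha, c, C.min'_mem hne, h⟩), h⟩)
  by_cases hJG : J ∈ groebnerCircuits 𝔐
  · exact ⟨J, hJG, hJI⟩
  · rw [mem_groebnerCircuits] at hJG
    push Not at hJG
    obtain ⟨K, hK, -, hKJ⟩ := hJG hdep
    exact ⟨K, hK, hKJ.trans hJI⟩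

theorem sort_union_of_forall_lt {X Y : Finset S} (h : ∀ x ∈ X, ∀ y ∈ Y, x < y) :
    (X ∪ Y).sort (· ≤ ·) = X.sort (· ≤ ·) ++ Y.sort (· ≤ ·) := by
  have hnd : (X.sort (· ≤ ·) ++ Y.sort (· ≤ ·)).Nodup :=
    List.nodup_append.2 ⟨X.sort_nodup _, Y.sort_nodup _, fun x hx y hy =>
      (h x (by simpa using hx) y (by simpa using hy)).ne⟩
  have : X ∪ Y = (X.sort (· ≤ ·) ++ Y.sort (· ≤ ·)).toFinset := by simp
  rw [this, List.toFinset_sort _ hnd]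
  exact List.pairwise_append.2 ⟨X.pairwise_sort _, Y.pairwise_sort _, fun x hx y hy =>
    (h x (by simpa using hx) y (by simpa using hy)).le⟩

/-- The elements of a convex subset are consecutive. -/
theorem IsConvexSubset.sort_isInfix {K I : Finset S} (h : IsConvexSubset K I) :
    K.sort (· ≤ ·) <:+: I.sort (· ≤ ·) := by
  let X := I.filter fun i => ∀ k ∈ K, i < k
  let Y := I.filter fun i => i ∉ K ∧ ∃ k ∈ K, k ≤ i
  have hI : I = X ∪ (K ∪ Y) := by
    ext i
    simp only [X, Y, Finset.mem_union, Finset.mem_filter]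
    constructor
    · intro hi
      by_cases hK : i ∈ K
      · exact .inr (.inl hK)
      · by_cases hX : ∀ k ∈ K, i < k
        · exact .inl ⟨hi, hX⟩
        · push Not at hX
          exact .inr (.inr ⟨hi, hK, hX⟩)
    · rintro (hi | hi | hi)
      exacts [hi.1, h.1 hi, hi.1]
  have hKY : ∀ k ∈ K, ∀ y ∈ Y, k < y := by
    intro k hk y hy
    obtain ⟨hyI, hyK, k', hk', hle⟩ := Finset.mem_filter.1 hy
    by_contra! hyk
    exact hyK (h.2 y hyI k' hk' k hk (hle.lt_of_ne fun e => hyK (e ▸ hk'))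
      (hyk.lt_of_ne fun e => hyK (e ▸ hk)))
  have hX : ∀ x ∈ X, ∀ y ∈ K ∪ Y, x < y := by
    intro x hx y hy
    rcases Finset.mem_union.1 hy with hy | hy
    · exact (Finset.mem_filter.1 hx).2 y hy
    · obtain ⟨-, -, k, hk, hle⟩ := Finset.mem_filter.1 hy
      exact ((Finset.mem_filter.1 hx).2 k hk).trans_le hle
  rw [hI, sort_union_of_forall_lt hX, sort_union_of_forall_lt hKY]
  exact ⟨_, _, List.append_assoc _ _ _⟩

theorem exists_sort_eq_cons {K : Finset S} (hK : K.Nonempty) :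
    ∃ a, K.sort (· ≤ ·) = a :: (dropMin K).sort (· ≤ ·) := by
  refine ⟨K.min' hK, ?_⟩
  have h : K = insert (K.min' hK) (dropMin K) := by
    ext j
    simp only [Finset.mem_insert, mem_dropMin]
    constructor
    · intro hj
      rcases (K.min'_le j hj).eq_or_lt with h | h
      · exact .inl h.symm
      · exact .inr ⟨hj, _, K.min'_mem hK, h⟩
    · rintro (rfl | hj)
      exacts [K.min'_mem hK, hj.1]
  have hlt : ∀ b ∈ dropMin K, K.min' hK < b := by
    intro b hb
    obtain ⟨-, i, hi, hib⟩ := mem_dropMin.1 hb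
    exact (K.min'_le i hi).trans_lt hib
  conv_lhs => rw [h]
  exact Finset.sort_insert _ (fun b hb => (hlt b hb).le) fun hmem => lt_irrefl _ (hlt _ hmem)

end GroebnerCircuits

/-! ### Leading terms of the basis elements. -/

section LeadingTerms

variable {R S : Type*} [CommRing R]

theorem coeff_monom (m : FreeMonoid S) : (monom R m).coeff = Finsupp.single m 1 := rfl

theorem var_mul_var (r s : S) : var R r * var R s = monom R (FreeMonoid.ofList [r, s]) := by
  rw [monom_ofList]
  simp

theorem monom_mem_leadingTerms [LT S] {F : Set (NCPoly R S)} {f : NCPoly R S} (hf : f ∈ F)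
    {m : FreeMonoid S} (hm : IsLeadingMonomial f m) (hc : f.coeff m = 1) :
    monom R m ∈ leadingTerms F :=
  ⟨f, hf, m, hm, by rw [hc, monom]⟩

/-- The dividing monomial has coefficient 1, so the coefficient `c` of the multiple may be a
non-unit. -/
theorem single_mem_span_of_isInfix {F : Set (NCPoly R S)} {l m : List S}
    (hl : monom R (FreeMonoid.ofList l) ∈ TwoSidedIdeal.span F) (h : l <:+: m) (c : R) :
    MonoidAlgebra.single (FreeMonoid.ofList m) c ∈ TwoSidedIdeal.span F := by
  obtain ⟨u, v, rfl⟩ := h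
  have : (MonoidAlgebra.single (FreeMonoid.ofList (u ++ l ++ v)) c : NCPoly R S) =
      MonoidAlgebra.single (FreeMonoid.ofList u) c * monom R (FreeMonoid.ofList l) *
        monom R (FreeMonoid.ofList v) := by
    rw [monom, monom, MonoidAlgebra.single_mul_single, MonoidAlgebra.single_mul_single,
      FreeMonoid.ofList_append, FreeMonoid.ofList_append, mul_one, mul_one]
  rw [this]
  exact TwoSidedIdeal.mul_mem_right _ _ _ (TwoSidedIdeal.mul_mem_left _ _ _ hl)

theorem isLeadingMonomial_monom [Nontrivial R] [LT S] (m : FreeMonoid S) :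
    IsLeadingMonomial (monom R m) m := by
  simp only [IsLeadingMonomial, coeff_monom, Finsupp.mem_support_single]
  exact ⟨⟨trivial, one_ne_zero⟩, fun n hn hne => absurd hn.1 hne⟩

variable [LinearOrder S]

theorem isLeadingMonomial_monom_add [Nontrivial R] {m : FreeMonoid S} {f : NCPoly R S}
    (hf : ∀ n ∈ f.coeff.support, n ≠ m ∧ MonomLT n m) :
    IsLeadingMonomial (monom R m + f) m ∧ (monom R m + f).coeff m = 1 := by
  have h1 : (monom R m + f).coeff m = 1 := by
    have : f.coeff m = 0 := by
      by_contra h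
      exact (hf m (Finsupp.mem_support_iff.2 h)).1 rfl
    simp [MonoidAlgebra.coeff_add, coeff_monom, this]
  refine ⟨⟨Finsupp.mem_support_iff.2 (h1 ▸ one_ne_zero), fun n hn hne => (hf n ?_).2⟩, h1⟩
  simpa [MonoidAlgebra.coeff_add, coeff_monom, Finsupp.single_apply, hne.symm] using hn

/-- The leading term of the boundary of `K` is the monomial of `K` without its least element. -/
theorem isLeadingMonomial_boundary [Nontrivial R] {K : Finset S} (hK : K.Nonempty) :
    IsLeadingMonomial (boundary R K) (FreeMonoid.ofList ((dropMin K).sort (· ≤ ·))) ∧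
      (boundary R K).coeff (FreeMonoid.ofList ((dropMin K).sort (· ≤ ·))) = 1 := by
  obtain ⟨a, ha⟩ := exists_sort_eq_cons hK
  set t := (dropMin K).sort (· ≤ ·)
  have hsorted : (a :: t).Pairwise (· < ·) := ha ▸ K.sortedLT_sort.pairwise
  have hsum : boundary R K = monom R (FreeMonoid.ofList t) + ∑ i : Fin t.length,
      (-1 : R) ^ ((i : ℕ) + 1) • monom R (FreeMonoid.ofList (a :: t.eraseIdx i)) := by
    have hcard : K.card = t.length + 1 := by rw [← K.length_sort (· ≤ ·), ha, List.length_cons]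
    rw [boundary_eq_sum, Fintype.sum_equiv (finCongr hcard) _
      (fun i : Fin (t.length + 1) => (-1 : R) ^ (i : ℕ) •
        monom R (FreeMonoid.ofList ((a :: t).eraseIdx i))) (by simp [ha]), Fin.sum_univ_succ]
    simp
  rw [hsum]
  refine isLeadingMonomial_monom_add fun n hn => ?_
  obtain ⟨i, hi, rfl⟩ : ∃ i, i < t.length ∧ n = FreeMonoid.ofList (a :: t.eraseIdx i) := by
    classical
    rw [MonoidAlgebra.coeff_sum] at hn
    obtain ⟨i, -, hi⟩ := Finset.mem_biUnion.1 (Finsupp.support_finsetSum hn)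
    refine ⟨i, i.2, ?_⟩
    by_contra hne
    rw [MonoidAlgebra.coeff_smul, coeff_monom, Finsupp.mem_support_iff, Finsupp.smul_apply,
      Finsupp.single_eq_of_ne hne, smul_zero] at hi
    exact hi rfl
  clear hn hsum
  clear_value t
  cases ht : t with
  | nil => simp [ht] at hi
  | cons b s =>
    -- All other terms have the same degree but begin with the minimum `a`, whereas `t` begins with
    -- `b`.
    have hab : a < b := List.rel_of_pairwise_cons hsorted (by simp [ht])
    rw [ht] at hi
    refine ⟨fun h => hab.ne (List.cons.inj (FreeMonoid.ofList.injective h)).1, ?_⟩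
    refine List.Shortlex.of_lex ?_ (List.Lex.rel hab)
    simp only [FreeMonoid.toList_ofList, List.length_cons, List.length_eraseIdx]
    simp only [List.length_cons] at hi
    simp [hi]

end LeadingTerms

end OrlikSolomon

/-! ### The Gröbner basis. -/

/-- `M` is a matroid on the finite totally ordered ground set `S`, without loops and without
parallel elements (two distinct elements forming a circuit). -/
theorem corollary1p5 {R S : Type*} [CommRing R] [LinearOrder S] [Finite S]
    (M : Matroid S) (hE : M.E = Set.univ) (hloop : M.Loopless)
    (hpar : ∀ e f : S, e ≠ f → ¬ M.IsCircuit {e, f}) :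
    OrlikSolomon.IsGroebnerBasis
      ({p | ∃ s : S, p = OrlikSolomon.var R s ^ 2} ∪
        {p | ∃ r s : S, s < r ∧ p = OrlikSolomon.var R r * OrlikSolomon.var R s +
          OrlikSolomon.var R s * OrlikSolomon.var R r} ∪
        {p | ∃ J ∈ OrlikSolomon.groebnerCircuits (OrlikSolomon.circuits M),
          p = OrlikSolomon.boundary R J})
      (OrlikSolomon.definingIdeal (0 : R) (OrlikSolomon.circuits M)) := by
  open OrlikSolomon in
  have hempty : ∅ ∉ circuits M := fun h => by
    simpa using (mem_circuits.1 h).nonempty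
  set G := {p | ∃ s : S, p = var R s ^ 2} ∪
    {p | ∃ r s : S, s < r ∧ p = var R r * var R s + var R s * var R r} ∪
      {p | ∃ J ∈ groebnerCircuits (circuits M), p = boundary R J} with hG
  have hGI : ∀ g ∈ G, g ∈ definingIdeal (0 : R) (circuits M) := by
    rintro g ((⟨s, rfl⟩ | ⟨r, s, hrs, rfl⟩) | ⟨J, hJ, rfl⟩)
    · exact TwoSidedIdeal.subset_span (.inl (.inl ⟨s, by simp⟩))
    · exact TwoSidedIdeal.subset_span (.inl (.inr ⟨r, s, hrs, by simp⟩))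
    · exact boundary_mem_definingIdeal hempty ((mem_groebnerCircuits _ _).1 hJ).1
  refine ⟨hGI, le_antisymm (TwoSidedIdeal.span_mono ?_) (TwoSidedIdeal.span_le.2 ?_)⟩
  · rintro p ⟨f, hf, m, hm, rfl⟩
    exact ⟨f, hGI f hf, m, hm, rfl⟩
  rintro p ⟨f, hf, m, hm, rfl⟩
  have : Nontrivial R := nontrivial_of_ne _ _ (Finsupp.mem_support_iff.1 hm.1)
  obtain ⟨l, rfl⟩ := FreeMonoid.ofList.surjective m
  by_cases hl : l.Pairwise (· < ·)
  · by_cases hB : ∀ C ∈ circuits M, ¬ (dropMin C : Set S) ⊆ {a | a ∈ l}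
    · exact absurd hm (not_isLeadingMonomial_of_forall_not_subset hE hl hB hf)
    · push Not at hB
      obtain ⟨C, hC, hCl⟩ := hB
      have hlI : l.toFinset.sort (· ≤ ·) = l :=
        (List.toFinset_sort _ (hl.imp ne_of_lt)).2 (hl.imp le_of_lt)
      obtain ⟨K, hK, hKI⟩ := exists_groebnerCircuit (I := l.toFinset) hC
        (Finset.nonempty_iff_ne_empty.2 fun h => hempty (h ▸ hC))
        (fun a ha => List.mem_toFinset.2 (hCl ha))
      have hKne : K.Nonempty := by
        obtain ⟨D, hD, hDK⟩ := ((mem_groebnerCircuits _ _).1 hK).1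
        exact (Finset.nonempty_iff_ne_empty.2 fun h => hempty (h ▸ hD)).mono hDK
      obtain ⟨h1, h2⟩ := isLeadingMonomial_boundary (R := R) hKne
      refine single_mem_span_of_isInfix (TwoSidedIdeal.subset_span
        (monom_mem_leadingTerms (.inr ⟨K, hK, rfl⟩) h1 h2)) ?_ _
      simpa only [hlI] using hKI.sort_isInfix
  -- By transitivity, a word that is not strictly increasing has adjacent letters `a`, `b` with `b ≤
  -- a`.
  · rw [← List.isChain_iff_pairwise, List.isChain_iff_forall_rel_of_append_cons_cons] at hl
    push Not at hl
    obtain ⟨a, b, u, v, rfl, hba⟩ := hl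
    refine single_mem_span_of_isInfix (l := [a, b]) (TwoSidedIdeal.subset_span ?_)
      ⟨u, v, by simp⟩ _
    rcases hba.eq_or_lt with rfl | hba
    · refine monom_mem_leadingTerms (f := monom R (FreeMonoid.ofList [b, b]))
        (.inl (.inl ⟨b, by rw [sq, var_mul_var]⟩)) (isLeadingMonomial_monom _) ?_
      simp [coeff_monom]
    · obtain ⟨h1, h2⟩ := isLeadingMonomial_monom_add (m := FreeMonoid.ofList [a, b])
        (f := monom R (FreeMonoid.ofList [b, a])) fun n hn => by
          rw [coeff_monom, Finsupp.mem_support_single] at hn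
          obtain ⟨rfl, -⟩ := hn
          exact ⟨fun h => hba.ne (List.cons.inj (FreeMonoid.ofList.injective h)).1,
            List.Shortlex.of_lex rfl (List.Lex.rel hba)⟩
      exact monom_mem_leadingTerms
        (.inl (.inr ⟨a, b, hba, by rw [var_mul_var, var_mul_var]⟩)) h1 h2
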